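/- Let $\mathbb K\in\{\mathbb R,\mathbb C\}$, let $m,k\ge 1$, $n=m+k$, let $A\in\mathbb K^{m\times m}$ be Hermitian positive semidefinite and $B\in\mathbb K^{m\times k}$, with $\mathcal N(A)\cap\mathcal N(B^*)=\{0\}$ ($\mathcal N$ denotes the null space), and let $$H=\begin{bmatrix}A&B\\B^*&0\end{bmatrix}\in\mathbb K^{n\times n}.$$ For $x\in\mathbb K^m$ with Euclidean norm $\|x\|=1$ put $$p_\pm(x)=\frac{x^*Ax\pm\sqrt{(x^*Ax)^2+4x^*BB^*x}}{2},\qquad p_\pm^+=\max_{\|x\|=1}p_\pm(x),\qquad p_\pm^-=\min_{\|x\|=1}p_\pm(x);$$ these maxima and minima exist. Then the following hold. 1. (Extremal eigenvalues) $p_+^+$, $p_+^-$ and $p_-^-$ are eigenvalues of $H$. The number $p_-^+$ is an eigenvalue of $H$ if and only if $p_-^+\neq 0$ or $\mathcal N(B)\ne\{0\}$; in particular, it is one whenever $k\ge m$. 2. (Spectral inclusion) $\sigma(H)\subseteq[p_-^-,p_-^+]\cup[p_+^-,p_+^+]\cup\{0\}$, and $p_-^+\le 0\le p_+^-$, $p_-^+<p_+^-$.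 3. (Monotonicity) Let $\lambda_1(A,B)\ge\dots\ge\lambda_n(A,B)$ be the eigenvalues of $H$, counted with multiplicity. Then $\lambda_i(A,B)>0$ for $i\le m$ and $\lambda_i(A,B)\le0$ for $i>m$. If $A'\in\mathbb K^{m\times m}$ is Hermitian positive semidefinite with $x^*Ax\le x^*A'x$ for all $x\in\mathbb K^m$, then $\lambda_i(A,B)\le\lambda_i(A',B)$ for all $i$. If $B'\in\mathbb K^{m\times k}$ satisfies $x^*BB^*x\le x^*B'B'^*x$ for all $x\in\mathbb K^m$, then $\lambda_i(A,B)\le\lambda_i(A,B')$ for $i\le m$ and $\lambda_i(A,B')\le\lambda_i(A,B)$ for $i>m$. -/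

import Mathlib

open scoped Matrix ComplexOrder

namespace Stokes

variable {𝕜 : Type*} [RCLike 𝕜] {m k : ℕ}

/-- The Stokes matrix `[[A, B], [B*, 0]]` of order `n = m + k`. -/
def stokesMatrix (A : Matrix (Fin m) (Fin m) 𝕜) (B : Matrix (Fin m) (Fin k) 𝕜) :
    Matrix (Fin m ⊕ Fin k) (Fin m ⊕ Fin k) 𝕜 :=
  Matrix.fromBlocks A B Bᴴ 0

theorem stokesMatrix_isHermitian {A : Matrix (Fin m) (Fin m) 𝕜} (hA : A.PosSemidef)
    (B : Matrix (Fin m) (Fin k) 𝕜) : (stokesMatrix A B).IsHermitian :=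
  Matrix.IsHermitian.fromBlocks hA.isHermitian rfl Matrix.isHermitian_zero

/-- The eigenvalues of the Stokes matrix, repeated according to multiplicity, in decreasing
order `λ 0 ≥ λ 1 ≥ ⋯ ≥ λ (m + k - 1)`. -/
noncomputable def stokesEigenvalue {A : Matrix (Fin m) (Fin m) 𝕜} (hA : A.PosSemidef)
    (B : Matrix (Fin m) (Fin k) 𝕜) : Fin (Fintype.card (Fin m ⊕ Fin k)) → ℝ :=
  (stokesMatrix_isHermitian hA B).eigenvalues₀

/-- The quadratic form `x* M x` (real for Hermitian `M`). -/
noncomputable def quadForm (M : Matrix (Fin m) (Fin m) 𝕜) (x : EuclideanSpace 𝕜 (Fin m)) : ℝ :=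
  RCLike.re (star x.ofLp ⬝ᵥ (M *ᵥ x.ofLp))

/-- `Δ(x) = (x* A x)² + 4 x* B B* x`. -/
noncomputable def discr (A : Matrix (Fin m) (Fin m) 𝕜) (B : Matrix (Fin m) (Fin k) 𝕜)
    (x : EuclideanSpace 𝕜 (Fin m)) : ℝ :=
  quadForm A x ^ 2 + 4 * quadForm (B * Bᴴ) x

/-- `p₊(x) = (x* A x + √Δ(x)) / 2`. -/
noncomputable def pPlus (A : Matrix (Fin m) (Fin m) 𝕜) (B : Matrix (Fin m) (Fin k) 𝕜)
    (x : EuclideanSpace 𝕜 (Fin m)) : ℝ :=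
  (quadForm A x + √(discr A B x)) / 2

/-- `p₋(x) = (x* A x - √Δ(x)) / 2`. -/
noncomputable def pMinus (A : Matrix (Fin m) (Fin m) 𝕜) (B : Matrix (Fin m) (Fin k) 𝕜)
    (x : EuclideanSpace 𝕜 (Fin m)) : ℝ :=
  (quadForm A x - √(discr A B x)) / 2

/-- The set of values of `f` on the unit sphere of `𝕜 ^ m`. -/
def sphereValues (f : EuclideanSpace 𝕜 (Fin m) → ℝ) : Set ℝ :=
  f '' Metric.sphere (0 : EuclideanSpace 𝕜 (Fin m)) 1

/-- `μ` is an eigenvalue of the Stokes matrix of `A` and `B`. -/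
def IsStokesEigenvalue (A : Matrix (Fin m) (Fin m) 𝕜) (B : Matrix (Fin m) (Fin k) 𝕜)
    (μ : ℝ) : Prop :=
  Module.End.HasEigenvalue (Matrix.toLin' (stokesMatrix A B)) (μ : 𝕜)

end Stokes

open Stokes

/-! For `μ ≠ 0`, eliminating `y = μ⁻¹ B* x` from `H (x, y) = μ (x, y)` leaves `pencil A B μ x = 0`.
The pencil is Hermitian, and at a unit vector `x` its form equals `(μ - p₊(x)) (μ - p₋(x))`. Hence
every nonzero eigenvalue is a value of `p₊` or `p₋`. Conversely, `p₋ ≤ 0 < p₊`, so at a nonzero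
extremal value `μ` the form has constant sign on the sphere and vanishes at the extremiser. A
semidefinite matrix annihilates its isotropic vectors, so the extremiser lies in the kernel of the
pencil. The value `0` is treated apart: it is an eigenvalue exactly when `B` has a nontrivial
kernel.

Signs and monotonicity come from Courant–Fischer with strict inequalities. For monotonicity in `A`
the same test space serves. For monotonicity in `B`, a test space at level `μ` is projected to its
first block and lifted to the graph of `x ↦ μ⁻¹ B'* x`, the optimal second block for each `x`
(`lt_stokesEigenvalue_of_quadForm_le`, `stokesEigenvalue_lt_of_quadForm_le`). -/

theorem Submodule.exists_mem_mem_ne_zero_of_finrank_lt {K E : Type*} [Field K] [AddCommGroup E]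
    [Module K E] [FiniteDimensional K E]
    (V W : Submodule K E)
    (h : Module.finrank K E < Module.finrank K V + Module.finrank K W) :
    ∃ z ∈ V, z ∈ W ∧ z ≠ 0 := by
  have h1 := Submodule.finrank_sup_add_finrank_inf_eq V W
  have h2 := Submodule.finrank_le (V ⊔ W)
  have h3 : V ⊓ W ≠ ⊥ := by
    intro h0
    rw [h0, finrank_bot] at h1
    omega
  obtain ⟨z, hz, hz0⟩ := Submodule.exists_mem_ne_zero_of_ne_bot h3
  exact ⟨z, hz.1, hz.2, hz0⟩

/-! ### Courant–Fischer in strict form. -/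

namespace LinearMap.IsSymmetric

variable {𝕜 E : Type*} [RCLike 𝕜] [NormedAddCommGroup E] [InnerProductSpace 𝕜 E]
  [FiniteDimensional 𝕜 E] {T : E →ₗ[𝕜] E} {n : ℕ}

/-- The quadratic form of a symmetric operator in coordinates of an eigenvector basis. -/
theorem re_inner_apply_self_eq_sum (hT : T.IsSymmetric) (hn : Module.finrank 𝕜 E = n) (z : E) :
    RCLike.re (inner 𝕜 z (T z)) =
      ∑ i, hT.eigenvalues hn i * ‖(hT.eigenvectorBasis hn).repr z i‖ ^ 2 := by
  rw [← (hT.eigenvectorBasis hn).repr.inner_map_map z (T z), PiLp.inner_apply, map_sum]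
  refine Finset.sum_congr rfl fun i _ => ?_
  rw [hT.eigenvectorBasis_apply_self_apply hn z i, ← smul_eq_mul, inner_smul_right,
    inner_self_eq_norm_sq_to_K]
  norm_cast

theorem norm_sq_eq_sum_repr_eigenvectorBasis (hT : T.IsSymmetric) (hn : Module.finrank 𝕜 E = n)
    (z : E) : ‖z‖ ^ 2 = ∑ i, ‖(hT.eigenvectorBasis hn).repr z i‖ ^ 2 := by
  rw [← (hT.eigenvectorBasis hn).repr.norm_map z, EuclideanSpace.norm_sq_eq]

/-- The span of the eigenvectors with index in `S`. -/
noncomputable def eigenspan (hT : T.IsSymmetric) (hn : Module.finrank 𝕜 E = n)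
    (S : Finset (Fin n)) : Submodule 𝕜 E :=
  Submodule.span 𝕜 (Set.range fun i : S => hT.eigenvectorBasis hn i)

theorem finrank_eigenspan (hT : T.IsSymmetric) (hn : Module.finrank 𝕜 E = n)
    (S : Finset (Fin n)) : Module.finrank 𝕜 (hT.eigenspan hn S) = S.card := by
  have h := ((hT.eigenvectorBasis hn).toBasis.linearIndependent).comp
    (fun i : S => (i : Fin n)) Subtype.val_injective
  simpa using! finrank_span_eq_card h

theorem repr_eq_zero_of_mem_eigenspan (hT : T.IsSymmetric) (hn : Module.finrank 𝕜 E = n)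
    {S : Finset (Fin n)} {z : E} (hz : z ∈ hT.eigenspan hn S) {i : Fin n} (hi : i ∉ S) :
    (hT.eigenvectorBasis hn).repr z i = 0 := by
  induction hz using Submodule.span_induction with
  | mem x hx =>
    obtain ⟨j, rfl⟩ := hx
    have : i ≠ j := fun h => hi (h ▸ j.2)
    simp [OrthonormalBasis.repr_self, this]
  | zero => simp
  | add x y _ _ hx hy => simp [hx, hy]
  | smul a x _ hx => simp [hx]

theorem le_re_inner_of_mem_eigenspan (hT : T.IsSymmetric) (hn : Module.finrank 𝕜 E = n)
    {S : Finset (Fin n)} {μ : ℝ} (hS : ∀ i ∈ S, μ ≤ hT.eigenvalues hn i) {z : E}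
    (hz : z ∈ hT.eigenspan hn S) : μ * ‖z‖ ^ 2 ≤ RCLike.re (inner 𝕜 z (T z)) := by
  rw [hT.re_inner_apply_self_eq_sum hn, hT.norm_sq_eq_sum_repr_eigenvectorBasis hn,
    Finset.mul_sum]
  refine Finset.sum_le_sum fun i _ => ?_
  by_cases hi : i ∈ S
  · exact mul_le_mul_of_nonneg_right (hS i hi) (by positivity)
  · simp [hT.repr_eq_zero_of_mem_eigenspan hn hz hi]

theorem re_inner_le_of_mem_eigenspan (hT : T.IsSymmetric) (hn : Module.finrank 𝕜 E = n)
    {S : Finset (Fin n)} {μ : ℝ} (hS : ∀ i ∈ S, hT.eigenvalues hn i ≤ μ) {z : E}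
    (hz : z ∈ hT.eigenspan hn S) : RCLike.re (inner 𝕜 z (T z)) ≤ μ * ‖z‖ ^ 2 := by
  rw [hT.re_inner_apply_self_eq_sum hn, hT.norm_sq_eq_sum_repr_eigenvectorBasis hn,
    Finset.mul_sum]
  refine Finset.sum_le_sum fun i _ => ?_
  by_cases hi : i ∈ S
  · exact mul_le_mul_of_nonneg_right (hS i hi) (by positivity)
  · simp [hT.repr_eq_zero_of_mem_eigenspan hn hz hi]

/-- **Courant–Fischer**, lower bounds for eigenvalues. -/
theorem lt_eigenvalues_iff (hT : T.IsSymmetric) (hn : Module.finrank 𝕜 E = n) (i : Fin n)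
    (μ : ℝ) : μ < hT.eigenvalues hn i ↔ ∃ W : Submodule 𝕜 E, (i : ℕ) + 1 ≤ Module.finrank 𝕜 W ∧
      ∀ z ∈ W, z ≠ 0 → μ * ‖z‖ ^ 2 < RCLike.re (inner 𝕜 z (T z)) := by
  constructor
  · intro h
    refine ⟨hT.eigenspan hn (Finset.Iic i), by simp [finrank_eigenspan], fun z hz hz0 => ?_⟩
    refine lt_of_lt_of_le ?_ (hT.le_re_inner_of_mem_eigenspan hn
      (fun j hj => hT.eigenvalues_antitone hn (Finset.mem_Iic.1 hj)) hz)
    have := norm_pos_iff.2 hz0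
    gcongr
  · rintro ⟨W, hW, hform⟩
    -- Indices start at 0, so the span over `Ici i` has dimension `n - i`, and with `i + 1` the
    -- total exceeds `n`.
    obtain ⟨z, hz, hz', hz0⟩ := Submodule.exists_mem_mem_ne_zero_of_finrank_lt W
      (hT.eigenspan hn (Finset.Ici i)) (by
        rw [finrank_eigenspan, Fin.card_Ici, hn]; omega)
    have h1 := (hform z hz hz0).trans_le (hT.re_inner_le_of_mem_eigenspan hn
      (fun j hj => hT.eigenvalues_antitone hn (Finset.mem_Ici.1 hj)) hz')
    exact lt_of_mul_lt_mul_right h1 (by positivity)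

/-- **Courant–Fischer**, upper bounds for eigenvalues. -/
theorem eigenvalues_lt_iff (hT : T.IsSymmetric) (hn : Module.finrank 𝕜 E = n) (i : Fin n)
    (μ : ℝ) : hT.eigenvalues hn i < μ ↔ ∃ W : Submodule 𝕜 E, n ≤ Module.finrank 𝕜 W + i ∧
      ∀ z ∈ W, z ≠ 0 → RCLike.re (inner 𝕜 z (T z)) < μ * ‖z‖ ^ 2 := by
  constructor
  · intro h
    refine ⟨hT.eigenspan hn (Finset.Ici i), by rw [finrank_eigenspan, Fin.card_Ici]; omega,
      fun z hz hz0 => ?_⟩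
    refine lt_of_le_of_lt (hT.re_inner_le_of_mem_eigenspan hn
      (fun j hj => hT.eigenvalues_antitone hn (Finset.mem_Ici.1 hj)) hz) ?_
    have := norm_pos_iff.2 hz0
    gcongr
  · rintro ⟨W, hW, hform⟩
    obtain ⟨z, hz, hz', hz0⟩ := Submodule.exists_mem_mem_ne_zero_of_finrank_lt W
      (hT.eigenspan hn (Finset.Iic i)) (by
        rw [finrank_eigenspan, Fin.card_Iic, hn]; omega)
    have h1 := (hT.le_re_inner_of_mem_eigenspan hn
      (fun j hj => hT.eigenvalues_antitone hn (Finset.mem_Iic.1 hj)) hz').trans_lt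
        (hform z hz hz0)
    exact lt_of_mul_lt_mul_right h1 (by positivity)

end LinearMap.IsSymmetric

/-! ### Block coordinates and the quadratic form of the Stokes matrix. -/

namespace Stokes

variable {𝕜 : Type*} [RCLike 𝕜] {m k : ℕ}

/-- The first block of a vector of length `m + k`. -/
noncomputable def blockFst :
    EuclideanSpace 𝕜 (Fin m ⊕ Fin k) →ₗ[𝕜] EuclideanSpace 𝕜 (Fin m) where
  toFun z := WithLp.toLp 2 fun i => z (Sum.inl i)
  map_add' _ _ := rfl
  map_smul' _ _ := rfl

/-- The second block of a vector of length `m + k`. -/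
noncomputable def blockSnd :
    EuclideanSpace 𝕜 (Fin m ⊕ Fin k) →ₗ[𝕜] EuclideanSpace 𝕜 (Fin k) where
  toFun z := WithLp.toLp 2 fun i => z (Sum.inr i)
  map_add' _ _ := rfl
  map_smul' _ _ := rfl

@[simp]
theorem blockFst_apply (z : EuclideanSpace 𝕜 (Fin m ⊕ Fin k)) (i : Fin m) :
    blockFst z i = z (Sum.inl i) := rfl

@[simp]
theorem blockSnd_apply (z : EuclideanSpace 𝕜 (Fin m ⊕ Fin k)) (i : Fin k) :
    blockSnd z i = z (Sum.inr i) := rfl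

/-- The map `x ↦ (x, t B* x)`. -/
noncomputable def graphMap (B : Matrix (Fin m) (Fin k) 𝕜) (t : ℝ) :
    EuclideanSpace 𝕜 (Fin m) →ₗ[𝕜] EuclideanSpace 𝕜 (Fin m ⊕ Fin k) where
  toFun x := WithLp.toLp 2 (Sum.elim x.ofLp (((t : 𝕜) • Bᴴ.toEuclideanLin x).ofLp))
  map_add' x y := by
    ext i
    cases i <;> simp
  map_smul' c x := by
    ext i
    cases i <;> simp

@[simp]
theorem blockFst_graphMap (B : Matrix (Fin m) (Fin k) 𝕜) (t : ℝ)
    (x : EuclideanSpace 𝕜 (Fin m)) : blockFst (graphMap B t x) = x := rfl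

@[simp]
theorem blockSnd_graphMap (B : Matrix (Fin m) (Fin k) 𝕜) (t : ℝ)
    (x : EuclideanSpace 𝕜 (Fin m)) :
    blockSnd (graphMap B t x) = (t : 𝕜) • Bᴴ.toEuclideanLin x := rfl

theorem graphMap_injective (B : Matrix (Fin m) (Fin k) 𝕜) (t : ℝ) :
    Function.Injective (graphMap B t) :=
  Function.LeftInverse.injective (g := blockFst) (blockFst_graphMap B t)

theorem norm_sq_eq_blocks (z : EuclideanSpace 𝕜 (Fin m ⊕ Fin k)) :
    ‖z‖ ^ 2 = ‖blockFst z‖ ^ 2 + ‖blockSnd z‖ ^ 2 := by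
  simp [EuclideanSpace.norm_sq_eq]

theorem quadForm_eq_re_inner (M : Matrix (Fin m) (Fin m) 𝕜) (x : EuclideanSpace 𝕜 (Fin m)) :
    quadForm M x = RCLike.re (inner 𝕜 x (M.toEuclideanLin x)) := by
  rw [EuclideanSpace.inner_eq_star_dotProduct, dotProduct_comm]
  rfl

theorem quadForm_mul_conjTranspose (B : Matrix (Fin m) (Fin k) 𝕜)
    (x : EuclideanSpace 𝕜 (Fin m)) :
    quadForm (B * Bᴴ) x = ‖Bᴴ.toEuclideanLin x‖ ^ 2 := by
  rw [quadForm_eq_re_inner, Matrix.toLpLin_mul_same, ← inner_self_eq_norm_sq (𝕜 := 𝕜),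
    LinearMap.comp_apply, Matrix.toEuclideanLin_conjTranspose_eq_adjoint,
    LinearMap.adjoint_inner_left]

/-- The quadratic form of the Stokes matrix in block coordinates. -/
theorem re_inner_stokesMatrix (A : Matrix (Fin m) (Fin m) 𝕜) (B : Matrix (Fin m) (Fin k) 𝕜)
    (z : EuclideanSpace 𝕜 (Fin m ⊕ Fin k)) :
    RCLike.re (inner 𝕜 z ((stokesMatrix A B).toEuclideanLin z)) =
      quadForm A (blockFst z) +
        2 * RCLike.re (inner 𝕜 (Bᴴ.toEuclideanLin (blockFst z)) (blockSnd z)) := by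
  have h1 : blockFst ((stokesMatrix A B).toEuclideanLin z) =
      A.toEuclideanLin (blockFst z) + B.toEuclideanLin (blockSnd z) := by
    ext i
    simp [stokesMatrix, Matrix.mulVec, dotProduct]
  have h2 : blockSnd ((stokesMatrix A B).toEuclideanLin z) =
      Bᴴ.toEuclideanLin (blockFst z) := by
    ext i
    simp [stokesMatrix, Matrix.mulVec, dotProduct]
  have h3 : inner 𝕜 z ((stokesMatrix A B).toEuclideanLin z) =
      inner 𝕜 (blockFst z) (blockFst ((stokesMatrix A B).toEuclideanLin z)) +
        inner 𝕜 (blockSnd z) (blockSnd ((stokesMatrix A B).toEuclideanLin z)) := by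
    simp only [PiLp.inner_apply, Fintype.sum_sum_type]
    rfl
  rw [h3, h1, h2, inner_add_right, map_add, map_add, quadForm_eq_re_inner,
    inner_re_symm (blockSnd z), Matrix.toEuclideanLin_conjTranspose_eq_adjoint,
    LinearMap.adjoint_inner_left]
  ring

theorem re_inner_stokesMatrix_graphMap (A : Matrix (Fin m) (Fin m) 𝕜)
    (B : Matrix (Fin m) (Fin k) 𝕜) (t : ℝ) (x : EuclideanSpace 𝕜 (Fin m)) :
    RCLike.re (inner 𝕜 (graphMap B t x) ((stokesMatrix A B).toEuclideanLin (graphMap B t x))) =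
      quadForm A x + 2 * t * ‖Bᴴ.toEuclideanLin x‖ ^ 2 := by
  rw [re_inner_stokesMatrix, blockFst_graphMap, blockSnd_graphMap, inner_smul_right,
    RCLike.re_ofReal_mul, inner_self_eq_norm_sq]
  ring

theorem norm_sq_graphMap (B : Matrix (Fin m) (Fin k) 𝕜) (t : ℝ)
    (x : EuclideanSpace 𝕜 (Fin m)) :
    ‖graphMap B t x‖ ^ 2 = ‖x‖ ^ 2 + t ^ 2 * ‖Bᴴ.toEuclideanLin x‖ ^ 2 := by
  rw [norm_sq_eq_blocks, blockFst_graphMap, blockSnd_graphMap, norm_smul, mul_pow]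
  simp

/-- Completing the square: `|w - t y|² = |w|² - 2 t Re⟨w, y⟩ + t² |y|²`. -/
theorem norm_sub_ofReal_smul_sq {E : Type*} [NormedAddCommGroup E] [InnerProductSpace 𝕜 E]
    (t : ℝ) (w y : E) :
    ‖w - (t : 𝕜) • y‖ ^ 2 =
      ‖w‖ ^ 2 - 2 * t * RCLike.re (inner 𝕜 w y) + t ^ 2 * ‖y‖ ^ 2 := by
  rw [norm_sub_sq (𝕜 := 𝕜), inner_smul_right, RCLike.re_ofReal_mul, norm_smul, mul_pow]
  simp
  ring

theorem quadForm_nonneg {A : Matrix (Fin m) (Fin m) 𝕜} (hA : A.PosSemidef)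
    (x : EuclideanSpace 𝕜 (Fin m)) : 0 ≤ quadForm A x :=
  hA.re_dotProduct_nonneg x.ofLp

theorem mulVec_eq_zero_of_quadForm_eq_zero {A : Matrix (Fin m) (Fin m) 𝕜} (hA : A.PosSemidef)
    {x : EuclideanSpace 𝕜 (Fin m)} (hx : quadForm A x = 0) : A *ᵥ x.ofLp = 0 := by
  rw [← hA.dotProduct_mulVec_zero_iff]
  apply RCLike.ext
  · simpa [quadForm] using! hx
  · simpa using! (RCLike.nonneg_iff.1 (hA.dotProduct_mulVec_nonneg x.ofLp)).2

theorem lt_stokesEigenvalue_iff {A : Matrix (Fin m) (Fin m) 𝕜} (hA : A.PosSemidef)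
    (B : Matrix (Fin m) (Fin k) 𝕜) (i : Fin (Fintype.card (Fin m ⊕ Fin k))) (μ : ℝ) :
    μ < stokesEigenvalue hA B i ↔ ∃ W : Submodule 𝕜 (EuclideanSpace 𝕜 (Fin m ⊕ Fin k)),
      (i : ℕ) + 1 ≤ Module.finrank 𝕜 W ∧ ∀ z ∈ W, z ≠ 0 →
        μ * ‖z‖ ^ 2 < RCLike.re (inner 𝕜 z ((stokesMatrix A B).toEuclideanLin z)) :=
  LinearMap.IsSymmetric.lt_eigenvalues_iff _ _ i μ

theorem stokesEigenvalue_lt_iff {A : Matrix (Fin m) (Fin m) 𝕜} (hA : A.PosSemidef)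
    (B : Matrix (Fin m) (Fin k) 𝕜) (i : Fin (Fintype.card (Fin m ⊕ Fin k))) (μ : ℝ) :
    stokesEigenvalue hA B i < μ ↔ ∃ W : Submodule 𝕜 (EuclideanSpace 𝕜 (Fin m ⊕ Fin k)),
      Fintype.card (Fin m ⊕ Fin k) ≤ Module.finrank 𝕜 W + i ∧ ∀ z ∈ W, z ≠ 0 →
        RCLike.re (inner 𝕜 z ((stokesMatrix A B).toEuclideanLin z)) < μ * ‖z‖ ^ 2 :=
  LinearMap.IsSymmetric.eigenvalues_lt_iff _ _ i μ

theorem finrank_map_blockFst (W : Submodule 𝕜 (EuclideanSpace 𝕜 (Fin m ⊕ Fin k)))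
    (hW : ∀ z ∈ W, blockFst z = 0 → z = 0) :
    Module.finrank 𝕜 (W.map blockFst) = Module.finrank 𝕜 W := by
  have hinj : Function.Injective (blockFst.domRestrict W) := by
    rw [injective_iff_map_eq_zero]
    rintro ⟨z, hz⟩ h
    exact Subtype.ext (hW z hz h)
  rw [← LinearMap.finrank_range_of_inj hinj, LinearMap.range_domRestrict]

theorem finrank_map_graphMap (B : Matrix (Fin m) (Fin k) 𝕜) (t : ℝ)
    (U : Submodule 𝕜 (EuclideanSpace 𝕜 (Fin m))) :
    Module.finrank 𝕜 (U.map (graphMap B t)) = Module.finrank 𝕜 U :=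
  (Submodule.equivMapOfInjective _ (graphMap_injective B t) U).finrank_eq.symm

/-- A vector with vanishing first block is isotropic for the Stokes matrix. -/
theorem re_inner_stokesMatrix_of_blockFst_eq_zero (A : Matrix (Fin m) (Fin m) 𝕜)
    (B : Matrix (Fin m) (Fin k) 𝕜) {z : EuclideanSpace 𝕜 (Fin m ⊕ Fin k)}
    (hz : blockFst z = 0) :
    RCLike.re (inner 𝕜 z ((stokesMatrix A B).toEuclideanLin z)) = 0 := by
  rw [re_inner_stokesMatrix, hz]
  simp [quadForm]

/-- This is the form in which the null space condition is used: if both nonnegative terms vanish,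
then `x` lies in both kernels. -/
theorem quadForm_add_pos {A : Matrix (Fin m) (Fin m) 𝕜} {B : Matrix (Fin m) (Fin k) 𝕜}
    (hA : A.PosSemidef)
    (hAB : LinearMap.ker (Matrix.toLin' A) ⊓ LinearMap.ker (Matrix.toLin' Bᴴ) = ⊥)
    (x : EuclideanSpace 𝕜 (Fin m)) (hx : x ≠ 0) :
    0 < quadForm A x + quadForm (B * Bᴴ) x := by
  have ha := quadForm_nonneg hA x
  have hb := quadForm_mul_conjTranspose B x
  have hb0 : 0 ≤ quadForm (B * Bᴴ) x := by rw [hb]; positivity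
  refine lt_of_le_of_ne (by positivity) fun h => hx ?_
  have ha0 : quadForm A x = 0 := by linarith
  have hb1 : ‖Bᴴ.toEuclideanLin x‖ ^ 2 = 0 := by linarith
  have hmem : x.ofLp ∈ LinearMap.ker (Matrix.toLin' A) ⊓ LinearMap.ker (Matrix.toLin' Bᴴ) := by
    refine ⟨?_, ?_⟩
    · simpa using mulVec_eq_zero_of_quadForm_eq_zero hA ha0
    · have : Bᴴ.toEuclideanLin x = 0 := by simpa using hb1
      simpa using congrArg WithLp.ofLp this
  rw [hAB, Submodule.mem_bot] at hmem
  exact WithLp.ofLp_injective 2 hmem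

/-! ### Signs and monotonicity of the ordered eigenvalues. -/

theorem stokesEigenvalue_pos {A : Matrix (Fin m) (Fin m) 𝕜} (hA : A.PosSemidef)
    {B : Matrix (Fin m) (Fin k) 𝕜}
    (hpos : ∀ x : EuclideanSpace 𝕜 (Fin m), x ≠ 0 → 0 < quadForm A x + quadForm (B * Bᴴ) x)
    (i : Fin (Fintype.card (Fin m ⊕ Fin k))) (hi : (i : ℕ) < m) :
    0 < stokesEigenvalue hA B i := by
  rw [lt_stokesEigenvalue_iff]
  -- On the vectors `(x, B* x)`, an `m`-dimensional space, the form is `x* A x + 2 |B* x|²`.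
  refine ⟨(⊤ : Submodule 𝕜 _).map (graphMap B 1), ?_, ?_⟩
  · rw [finrank_map_graphMap, finrank_top, finrank_euclideanSpace_fin]
    omega
  · rintro _ ⟨x, -, rfl⟩ hx
    have hx0 : x ≠ 0 := fun h => hx (by rw [h, map_zero])
    have h := hpos x hx0
    rw [quadForm_mul_conjTranspose] at h
    rw [re_inner_stokesMatrix_graphMap, zero_mul]
    have : 0 ≤ ‖Bᴴ.toEuclideanLin x‖ ^ 2 := by positivity
    linarith

theorem stokesEigenvalue_nonpos {A : Matrix (Fin m) (Fin m) 𝕜} (hA : A.PosSemidef)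
    (B : Matrix (Fin m) (Fin k) 𝕜) (i : Fin (Fintype.card (Fin m ⊕ Fin k)))
    (hi : m ≤ (i : ℕ)) : stokesEigenvalue hA B i ≤ 0 := by
  by_contra! h
  obtain ⟨W, hW, hform⟩ := (lt_stokesEigenvalue_iff hA B i 0).1 h
  have hinj : ∀ z ∈ W, blockFst z = 0 → z = 0 := by
    intro z hz hz0
    by_contra hne
    have := hform z hz hne
    rw [re_inner_stokesMatrix_of_blockFst_eq_zero A B hz0] at this
    simp at this
  -- The first block embeds `W` into a space of dimension `m`, while `W` has dimension at least `i +
  -- 1 > m`.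
  have h1 := Submodule.finrank_le (W.map blockFst)
  rw [finrank_map_blockFst W hinj, finrank_euclideanSpace_fin] at h1
  omega

theorem stokesEigenvalue_mono_left {A A' : Matrix (Fin m) (Fin m) 𝕜} (hA : A.PosSemidef)
    (hA' : A'.PosSemidef) (B : Matrix (Fin m) (Fin k) 𝕜)
    (h : ∀ x, quadForm A x ≤ quadForm A' x) (i : Fin (Fintype.card (Fin m ⊕ Fin k))) :
    stokesEigenvalue hA B i ≤ stokesEigenvalue hA' B i := by
  refine le_of_forall_lt fun μ hμ => ?_
  obtain ⟨W, hW, hform⟩ := (lt_stokesEigenvalue_iff hA B i μ).1 hμ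
  refine (lt_stokesEigenvalue_iff hA' B i μ).2 ⟨W, hW, fun z hz hz0 => ?_⟩
  have h1 := hform z hz hz0
  rw [re_inner_stokesMatrix] at h1 ⊢
  linarith [h (blockFst z)]

/-- For `μ > 0` and fixed `x`, `2 Re⟨B* x, y⟩ - μ |y|²` is largest at `y = μ⁻¹ B* x`, with value
`μ⁻¹ |B* x|²`, which grows with `|B* x|`. Projection to the first block keeps the dimension of `W`,
because vectors with zero first block are isotropic and violate the strict bound. -/
theorem lt_stokesEigenvalue_of_quadForm_le {A : Matrix (Fin m) (Fin m) 𝕜} (hA : A.PosSemidef)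
    {B B' : Matrix (Fin m) (Fin k) 𝕜}
    (h : ∀ x, quadForm (B * Bᴴ) x ≤ quadForm (B' * B'ᴴ) x)
    (i : Fin (Fintype.card (Fin m ⊕ Fin k))) {μ : ℝ} (hμ : 0 < μ)
    (hi : μ < stokesEigenvalue hA B i) : μ < stokesEigenvalue hA B' i := by
  obtain ⟨W, hW, hform⟩ := (lt_stokesEigenvalue_iff hA B i μ).1 hi
  have hinj : ∀ z ∈ W, blockFst z = 0 → z = 0 := by
    intro z hz hz0
    by_contra hne
    have := hform z hz hne
    rw [re_inner_stokesMatrix_of_blockFst_eq_zero A B hz0] at this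
    have : 0 ≤ μ * ‖z‖ ^ 2 := by positivity
    linarith
  refine (lt_stokesEigenvalue_iff hA B' i μ).2
    ⟨(W.map blockFst).map (graphMap B' μ⁻¹), ?_, ?_⟩
  · rwa [finrank_map_graphMap, finrank_map_blockFst W hinj]
  · rintro _ ⟨_, ⟨z, hz, rfl⟩, rfl⟩ hne
    have h1 := hform z hz (fun h => hne (by rw [h, map_zero, map_zero]))
    have h2 := h (blockFst z)
    rw [quadForm_mul_conjTranspose, quadForm_mul_conjTranspose] at h2
    rw [re_inner_stokesMatrix, norm_sq_eq_blocks] at h1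
    have h3 := norm_sub_ofReal_smul_sq (𝕜 := 𝕜) μ (Bᴴ.toEuclideanLin (blockFst z)) (blockSnd z)
    rw [re_inner_stokesMatrix_graphMap, norm_sq_graphMap]
    generalize ‖(Matrix.toEuclideanLin B'ᴴ) (blockFst z)‖ ^ 2 = b' at *
    generalize ‖(Matrix.toEuclideanLin Bᴴ) (blockFst z)‖ ^ 2 = b at *
    -- Expand `0 ≤ |B* x - μ y|²` and replace `|B* x|²` by the larger `|B'* x|²`; division by `μ`
    -- then compares the two second blocks.
    have h4 : 0 ≤ b' - 2 * μ * RCLike.re (inner 𝕜 (Bᴴ.toEuclideanLin (blockFst z)) (blockSnd z))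
        + μ ^ 2 * ‖blockSnd z‖ ^ 2 := by
      have := sq_nonneg
        ‖(Matrix.toEuclideanLin Bᴴ) (blockFst z) - (μ : 𝕜) • blockSnd z‖
      linarith
    have h5 := mul_nonneg (inv_pos.2 hμ).le h4
    have h6 : μ⁻¹ * (b' - 2 * μ *
        RCLike.re (inner 𝕜 (Bᴴ.toEuclideanLin (blockFst z)) (blockSnd z))
        + μ ^ 2 * ‖blockSnd z‖ ^ 2) = μ⁻¹ * b' -
        2 * RCLike.re (inner 𝕜 (Bᴴ.toEuclideanLin (blockFst z)) (blockSnd z)) +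
        μ * ‖blockSnd z‖ ^ 2 := by field_simp
    have h7 : μ * (‖blockFst z‖ ^ 2 + μ⁻¹ ^ 2 * b') = μ * ‖blockFst z‖ ^ 2 + μ⁻¹ * b' := by
      field_simp
    rw [h7]
    linarith

/-- For `μ < 0` the choice `y = μ⁻¹ B* x` is a minimiser instead, and `μ⁻¹ |B* x|²` decreases as
`|B* x|` grows. -/
theorem stokesEigenvalue_lt_of_quadForm_le {A : Matrix (Fin m) (Fin m) 𝕜} (hA : A.PosSemidef)
    {B B' : Matrix (Fin m) (Fin k) 𝕜}
    (h : ∀ x, quadForm (B * Bᴴ) x ≤ quadForm (B' * B'ᴴ) x)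
    (i : Fin (Fintype.card (Fin m ⊕ Fin k))) {μ : ℝ} (hμ : μ < 0)
    (hi : stokesEigenvalue hA B i < μ) : stokesEigenvalue hA B' i < μ := by
  obtain ⟨W, hW, hform⟩ := (stokesEigenvalue_lt_iff hA B i μ).1 hi
  have hinj : ∀ z ∈ W, blockFst z = 0 → z = 0 := by
    intro z hz hz0
    by_contra hne
    have := hform z hz hne
    rw [re_inner_stokesMatrix_of_blockFst_eq_zero A B hz0] at this
    have : μ * ‖z‖ ^ 2 ≤ 0 := mul_nonpos_of_nonpos_of_nonneg hμ.le (by positivity)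
    linarith
  refine (stokesEigenvalue_lt_iff hA B' i μ).2
    ⟨(W.map blockFst).map (graphMap B' μ⁻¹), ?_, ?_⟩
  · rwa [finrank_map_graphMap, finrank_map_blockFst W hinj]
  · rintro _ ⟨_, ⟨z, hz, rfl⟩, rfl⟩ hne
    have h1 := hform z hz (fun h => hne (by rw [h, map_zero, map_zero]))
    have h2 := h (blockFst z)
    rw [quadForm_mul_conjTranspose, quadForm_mul_conjTranspose] at h2
    rw [re_inner_stokesMatrix, norm_sq_eq_blocks] at h1
    have h3 := norm_sub_ofReal_smul_sq (𝕜 := 𝕜) μ (Bᴴ.toEuclideanLin (blockFst z)) (blockSnd z)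
    rw [re_inner_stokesMatrix_graphMap, norm_sq_graphMap]
    generalize ‖(Matrix.toEuclideanLin B'ᴴ) (blockFst z)‖ ^ 2 = b' at *
    generalize ‖(Matrix.toEuclideanLin Bᴴ) (blockFst z)‖ ^ 2 = b at *
    have h4 : 0 ≤ b' - 2 * μ * RCLike.re (inner 𝕜 (Bᴴ.toEuclideanLin (blockFst z)) (blockSnd z))
        + μ ^ 2 * ‖blockSnd z‖ ^ 2 := by
      have := sq_nonneg
        ‖(Matrix.toEuclideanLin Bᴴ) (blockFst z) - (μ : 𝕜) • blockSnd z‖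
      linarith
    have h5 := mul_nonpos_of_nonpos_of_nonneg (inv_lt_zero.2 hμ).le h4
    have hμ0 : μ ≠ 0 := hμ.ne
    have h6 : μ⁻¹ * (b' - 2 * μ *
        RCLike.re (inner 𝕜 (Bᴴ.toEuclideanLin (blockFst z)) (blockSnd z))
        + μ ^ 2 * ‖blockSnd z‖ ^ 2) = μ⁻¹ * b' -
        2 * RCLike.re (inner 𝕜 (Bᴴ.toEuclideanLin (blockFst z)) (blockSnd z)) +
        μ * ‖blockSnd z‖ ^ 2 := by field_simp
    have h7 : μ * (‖blockFst z‖ ^ 2 + μ⁻¹ ^ 2 * b') = μ * ‖blockFst z‖ ^ 2 + μ⁻¹ * b' := by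
      field_simp
    rw [h7]
    linarith

theorem stokesEigenvalue_le_of_quadForm_le {A : Matrix (Fin m) (Fin m) 𝕜} (hA : A.PosSemidef)
    {B B' : Matrix (Fin m) (Fin k) 𝕜}
    (hpos : ∀ x : EuclideanSpace 𝕜 (Fin m), x ≠ 0 → 0 < quadForm A x + quadForm (B * Bᴴ) x)
    (h : ∀ x, quadForm (B * Bᴴ) x ≤ quadForm (B' * B'ᴴ) x)
    (i : Fin (Fintype.card (Fin m ⊕ Fin k))) (hi : (i : ℕ) < m) :
    stokesEigenvalue hA B i ≤ stokesEigenvalue hA B' i := by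
  by_contra! hlt
  -- The eigenvalue for `B'` itself serves as the level, which must be positive; `B'` inherits
  -- `hpos` from `B`.
  have h1 : 0 < stokesEigenvalue hA B' i :=
    stokesEigenvalue_pos hA (fun x hx => (hpos x hx).trans_le (by linarith [h x])) i hi
  exact lt_irrefl _ (lt_stokesEigenvalue_of_quadForm_le hA h i h1 hlt)

theorem stokesEigenvalue_ge_of_quadForm_le {A : Matrix (Fin m) (Fin m) 𝕜} (hA : A.PosSemidef)
    {B B' : Matrix (Fin m) (Fin k) 𝕜}
    (h : ∀ x, quadForm (B * Bᴴ) x ≤ quadForm (B' * B'ᴴ) x)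
    (i : Fin (Fintype.card (Fin m ⊕ Fin k))) (hi : m ≤ (i : ℕ)) :
    stokesEigenvalue hA B' i ≤ stokesEigenvalue hA B i := by
  by_contra! hlt
  -- The eigenvalue for `B'` may be `0`, so a strictly negative level is chosen below it.
  obtain ⟨μ, h1, h2⟩ := exists_between hlt
  have hμ : μ < 0 := h2.trans_le (stokesEigenvalue_nonpos hA B' i hi)
  exact lt_asymm h2 (stokesEigenvalue_lt_of_quadForm_le hA h i hμ h1)

/-! ### The functions `p₊` and `p₋`: Vieta relations, signs, continuity. -/

theorem quadForm_mul_conjTranspose_nonneg (B : Matrix (Fin m) (Fin k) 𝕜)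
    (x : EuclideanSpace 𝕜 (Fin m)) : 0 ≤ quadForm (B * Bᴴ) x := by
  rw [quadForm_mul_conjTranspose]
  positivity

theorem discr_nonneg (A : Matrix (Fin m) (Fin m) 𝕜) (B : Matrix (Fin m) (Fin k) 𝕜)
    (x : EuclideanSpace 𝕜 (Fin m)) : 0 ≤ discr A B x := by
  have := quadForm_mul_conjTranspose_nonneg B x
  unfold discr
  positivity

theorem pPlus_add_pMinus (A : Matrix (Fin m) (Fin m) 𝕜) (B : Matrix (Fin m) (Fin k) 𝕜)
    (x : EuclideanSpace 𝕜 (Fin m)) : pPlus A B x + pMinus A B x = quadForm A x := by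
  unfold pPlus pMinus
  ring

theorem pPlus_mul_pMinus (A : Matrix (Fin m) (Fin m) 𝕜) (B : Matrix (Fin m) (Fin k) 𝕜)
    (x : EuclideanSpace 𝕜 (Fin m)) : pPlus A B x * pMinus A B x = -quadForm (B * Bᴴ) x := by
  have h := Real.sq_sqrt (discr_nonneg A B x)
  have e : pPlus A B x * pMinus A B x = (quadForm A x ^ 2 - √(discr A B x) ^ 2) / 4 := by
    unfold pPlus pMinus
    ring
  rw [e, h, discr]
  ring

theorem pPlus_nonneg {A : Matrix (Fin m) (Fin m) 𝕜} (hA : A.PosSemidef)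
    (B : Matrix (Fin m) (Fin k) 𝕜) (x : EuclideanSpace 𝕜 (Fin m)) : 0 ≤ pPlus A B x := by
  have := quadForm_nonneg hA x
  unfold pPlus
  positivity

theorem pMinus_nonpos (A : Matrix (Fin m) (Fin m) 𝕜)
    (B : Matrix (Fin m) (Fin k) 𝕜) (x : EuclideanSpace 𝕜 (Fin m)) : pMinus A B x ≤ 0 := by
  have h : quadForm A x ≤ √(discr A B x) := by
    refine Real.le_sqrt_of_sq_le ?_
    have := quadForm_mul_conjTranspose_nonneg B x
    unfold discr
    linarith
  unfold pMinus
  linarith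

theorem pPlus_pos {A : Matrix (Fin m) (Fin m) 𝕜} (hA : A.PosSemidef)
    {B : Matrix (Fin m) (Fin k) 𝕜} {x : EuclideanSpace 𝕜 (Fin m)}
    (hx : 0 < quadForm A x + quadForm (B * Bᴴ) x) : 0 < pPlus A B x := by
  refine lt_of_le_of_ne (pPlus_nonneg hA B x) fun h => ?_
  have h1 := pPlus_add_pMinus A B x
  have h2 := pPlus_mul_pMinus A B x
  rw [← h] at h1 h2
  linarith [pMinus_nonpos A B x, quadForm_nonneg hA x]

theorem continuous_quadForm (M : Matrix (Fin m) (Fin m) 𝕜) : Continuous (quadForm M) := by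
  have h : quadForm M = fun x => RCLike.re (inner 𝕜 x (M.toEuclideanLin x)) :=
    funext (quadForm_eq_re_inner M)
  rw [h]
  have := LinearMap.continuous_of_finiteDimensional M.toEuclideanLin
  fun_prop

theorem continuous_discr (A : Matrix (Fin m) (Fin m) 𝕜) (B : Matrix (Fin m) (Fin k) 𝕜) :
    Continuous (discr A B) :=
  ((continuous_quadForm A).pow 2).add (continuous_const.mul (continuous_quadForm _))

theorem continuous_pPlus (A : Matrix (Fin m) (Fin m) 𝕜) (B : Matrix (Fin m) (Fin k) 𝕜) :
    Continuous (pPlus A B) :=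
  ((continuous_quadForm A).add (continuous_discr A B).sqrt).div_const 2

theorem continuous_pMinus (A : Matrix (Fin m) (Fin m) 𝕜) (B : Matrix (Fin m) (Fin k) 𝕜) :
    Continuous (pMinus A B) :=
  ((continuous_quadForm A).sub (continuous_discr A B).sqrt).div_const 2

theorem isCompact_sphereValues {f : EuclideanSpace 𝕜 (Fin m) → ℝ} (hf : Continuous f) :
    IsCompact (sphereValues f) :=
  (isCompact_sphere _ _).image hf

theorem sphereValues_nonempty (hm : 0 < m) (f : EuclideanSpace 𝕜 (Fin m) → ℝ) :
    (sphereValues f).Nonempty :=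
  ⟨_, EuclideanSpace.single ⟨0, hm⟩ 1, by simp, rfl⟩

/-! ### Nonzero eigenvalues and the quadratic pencil. -/

theorem isStokesEigenvalue_iff {A : Matrix (Fin m) (Fin m) 𝕜} {B : Matrix (Fin m) (Fin k) 𝕜}
    {μ : ℝ} : IsStokesEigenvalue A B μ ↔ ∃ (x : Fin m → 𝕜) (y : Fin k → 𝕜),
      (x ≠ 0 ∨ y ≠ 0) ∧ A *ᵥ x + B *ᵥ y = (μ : 𝕜) • x ∧ Bᴴ *ᵥ x = (μ : 𝕜) • y := by
  constructor
  · intro h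
    obtain ⟨z, hz, hz0⟩ := h.exists_hasEigenvector
    rw [Module.End.mem_eigenspace_iff, Matrix.toLin'_apply, stokesMatrix,
      Matrix.fromBlocks_mulVec] at hz
    refine ⟨z ∘ Sum.inl, z ∘ Sum.inr, ?_, ?_, ?_⟩
    · by_contra! h0
      refine hz0 (funext fun i => ?_)
      cases i with
      | inl i => exact congrFun h0.1 i
      | inr i => exact congrFun h0.2 i
    · exact funext fun i => congrFun hz (Sum.inl i)
    · ext i
      simpa using congrFun hz (Sum.inr i)
  · rintro ⟨x, y, h0, h1, h2⟩
    refine Module.End.hasEigenvalue_of_hasEigenvector (x := Sum.elim x y) ⟨?_, fun h => ?_⟩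
    · rw [Module.End.mem_eigenspace_iff, Matrix.toLin'_apply, stokesMatrix,
        Matrix.fromBlocks_mulVec]
      ext i
      cases i with
      | inl i => simpa using congrFun h1 i
      | inr i => simpa using congrFun h2 i
    · rcases h0 with h0 | h0
      · exact h0 (funext fun i => congrFun h (Sum.inl i))
      · exact h0 (funext fun i => congrFun h (Sum.inr i))

/-- The quadratic matrix polynomial `μ² I - μ A - B B*`. -/
def pencil (A : Matrix (Fin m) (Fin m) 𝕜) (B : Matrix (Fin m) (Fin k) 𝕜) (μ : ℝ) :
    Matrix (Fin m) (Fin m) 𝕜 :=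
  ((μ : 𝕜) ^ 2) • 1 - (μ : 𝕜) • A - B * Bᴴ

theorem pencil_isHermitian {A : Matrix (Fin m) (Fin m) 𝕜} (hA : A.IsHermitian)
    (B : Matrix (Fin m) (Fin k) 𝕜) (μ : ℝ) : (pencil A B μ).IsHermitian := by
  unfold Matrix.IsHermitian pencil
  simp [hA.eq]

theorem quadForm_pencil (A : Matrix (Fin m) (Fin m) 𝕜) (B : Matrix (Fin m) (Fin k) 𝕜) (μ : ℝ)
    (x : EuclideanSpace 𝕜 (Fin m)) : quadForm (pencil A B μ) x =
      μ ^ 2 * ‖x‖ ^ 2 - μ * quadForm A x - quadForm (B * Bᴴ) x := by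
  have h : (pencil A B μ).toEuclideanLin x = ((μ ^ 2 : ℝ) : 𝕜) • x
      - (μ : 𝕜) • A.toEuclideanLin x - (B * Bᴴ).toEuclideanLin x := by
    ext i
    simp [pencil, Matrix.smul_mulVec]
  rw [quadForm_eq_re_inner, h, inner_sub_right, inner_sub_right, inner_smul_right,
    inner_smul_right, map_sub, map_sub, RCLike.re_ofReal_mul, RCLike.re_ofReal_mul,
    inner_self_eq_norm_sq, quadForm_eq_re_inner, quadForm_eq_re_inner]

/-- On the unit sphere, `p₊(x)` and `p₋(x)` are the roots of the quadratic form of the pencil. -/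
theorem quadForm_pencil_of_norm_eq_one (A : Matrix (Fin m) (Fin m) 𝕜)
    (B : Matrix (Fin m) (Fin k) 𝕜) (μ : ℝ) {x : EuclideanSpace 𝕜 (Fin m)} (hx : ‖x‖ = 1) :
    quadForm (pencil A B μ) x = (μ - pPlus A B x) * (μ - pMinus A B x) := by
  rw [quadForm_pencil, hx]
  linear_combination μ * pPlus_add_pMinus A B x - pPlus_mul_pMinus A B x

theorem quadForm_smul (M : Matrix (Fin m) (Fin m) 𝕜) (c : ℝ) (x : EuclideanSpace 𝕜 (Fin m)) :
    quadForm M ((c : 𝕜) • x) = c ^ 2 * quadForm M x := by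
  rw [quadForm_eq_re_inner, quadForm_eq_re_inner, map_smul, inner_smul_left, inner_smul_right,
    RCLike.conj_ofReal, RCLike.re_ofReal_mul, RCLike.re_ofReal_mul]
  ring

theorem exists_unit_smul_eq {x : EuclideanSpace 𝕜 (Fin m)} (hx : x ≠ 0) :
    ∃ u : EuclideanSpace 𝕜 (Fin m), ‖u‖ = 1 ∧ x = ((‖x‖ : ℝ) : 𝕜) • u := by
  have h : ((‖x‖ : ℝ) : 𝕜) ≠ 0 := by simpa using hx
  refine ⟨((‖x‖ : ℝ) : 𝕜)⁻¹ • x, ?_, (smul_inv_smul₀ h x).symm⟩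
  rw [norm_smul, norm_inv, RCLike.norm_ofReal, abs_norm, inv_mul_cancel₀ (norm_ne_zero_iff.2 hx)]

theorem posSemidef_of_quadForm_nonneg {M : Matrix (Fin m) (Fin m) 𝕜} (hM : M.IsHermitian)
    (h : ∀ x : EuclideanSpace 𝕜 (Fin m), ‖x‖ = 1 → 0 ≤ quadForm M x) : M.PosSemidef := by
  rw [← Matrix.isPositive_toEuclideanLin_iff]
  refine ⟨Matrix.isSymmetric_toEuclideanLin_iff.2 hM, fun x => ?_⟩
  rw [inner_re_symm, ← quadForm_eq_re_inner]
  by_cases hx : x = 0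
  · simp [hx, quadForm]
  · obtain ⟨u, hu, hxu⟩ := exists_unit_smul_eq hx
    rw [hxu, quadForm_smul]
    exact mul_nonneg (sq_nonneg _) (h u hu)

theorem quadForm_neg (M : Matrix (Fin m) (Fin m) 𝕜) (x : EuclideanSpace 𝕜 (Fin m)) :
    quadForm (-M) x = -quadForm M x := by
  simp [quadForm, Matrix.neg_mulVec]

theorem isStokesEigenvalue_of_pencil_mulVec_eq_zero {A : Matrix (Fin m) (Fin m) 𝕜}
    {B : Matrix (Fin m) (Fin k) 𝕜} {μ : ℝ} (hμ : μ ≠ 0) {x : Fin m → 𝕜} (hx : x ≠ 0)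
    (h : pencil A B μ *ᵥ x = 0) : IsStokesEigenvalue A B μ := by
  have hμ' : (μ : 𝕜) ≠ 0 := by simpa using hμ
  refine isStokesEigenvalue_iff.2 ⟨x, (μ : 𝕜)⁻¹ • Bᴴ *ᵥ x, Or.inl hx, ?_, ?_⟩
  · rw [pencil, Matrix.sub_mulVec, Matrix.sub_mulVec, Matrix.smul_mulVec, Matrix.smul_mulVec,
      Matrix.one_mulVec, sub_eq_zero, ← Matrix.mulVec_mulVec] at h
    rw [Matrix.mulVec_smul, ← h, smul_sub, smul_smul, smul_smul, inv_mul_cancel₀ hμ', one_smul,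
      pow_two, inv_mul_cancel_left₀ hμ']
    abel
  · rw [smul_inv_smul₀ hμ']

/-- The pencil is positive semidefinite, so its isotropic vector `x` lies in its kernel. -/
theorem isStokesEigenvalue_of_quadForm_pencil_nonneg {A : Matrix (Fin m) (Fin m) 𝕜}
    (hA : A.PosSemidef) {B : Matrix (Fin m) (Fin k) 𝕜} {μ : ℝ} (hμ : μ ≠ 0)
    (h : ∀ x : EuclideanSpace 𝕜 (Fin m), ‖x‖ = 1 → 0 ≤ (μ - pPlus A B x) * (μ - pMinus A B x))
    {x : EuclideanSpace 𝕜 (Fin m)} (hx : ‖x‖ = 1)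
    (hx0 : (μ - pPlus A B x) * (μ - pMinus A B x) = 0) : IsStokesEigenvalue A B μ := by
  have hT : (pencil A B μ).PosSemidef :=
    posSemidef_of_quadForm_nonneg (pencil_isHermitian hA.isHermitian B μ) fun x hx => by
      rw [quadForm_pencil_of_norm_eq_one A B μ hx]
      exact h x hx
  refine isStokesEigenvalue_of_pencil_mulVec_eq_zero hμ (x := x.ofLp) ?_
    (mulVec_eq_zero_of_quadForm_eq_zero hT ?_)
  · intro h0
    have : x = 0 := WithLp.ofLp_injective 2 h0
    simp [this] at hx
  · rw [quadForm_pencil_of_norm_eq_one A B μ hx, hx0]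

theorem isStokesEigenvalue_of_quadForm_pencil_nonpos {A : Matrix (Fin m) (Fin m) 𝕜}
    (hA : A.PosSemidef) {B : Matrix (Fin m) (Fin k) 𝕜} {μ : ℝ} (hμ : μ ≠ 0)
    (h : ∀ x : EuclideanSpace 𝕜 (Fin m), ‖x‖ = 1 → (μ - pPlus A B x) * (μ - pMinus A B x) ≤ 0)
    {x : EuclideanSpace 𝕜 (Fin m)} (hx : ‖x‖ = 1)
    (hx0 : (μ - pPlus A B x) * (μ - pMinus A B x) = 0) : IsStokesEigenvalue A B μ := by
  have hT : (-pencil A B μ).PosSemidef :=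
    posSemidef_of_quadForm_nonneg (pencil_isHermitian hA.isHermitian B μ).neg fun x hx => by
      rw [quadForm_neg, quadForm_pencil_of_norm_eq_one A B μ hx]
      exact neg_nonneg.2 (h x hx)
  refine isStokesEigenvalue_of_pencil_mulVec_eq_zero hμ (x := x.ofLp) ?_ ?_
  · intro h0
    have : x = 0 := WithLp.ofLp_injective 2 h0
    simp [this] at hx
  · have := mulVec_eq_zero_of_quadForm_eq_zero hT (x := x) (by
      rw [quadForm_neg, quadForm_pencil_of_norm_eq_one A B μ hx, hx0, neg_zero])
    rwa [Matrix.neg_mulVec, neg_eq_zero] at this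

theorem IsStokesEigenvalue.exists_eq {A : Matrix (Fin m) (Fin m) 𝕜}
    {B : Matrix (Fin m) (Fin k) 𝕜} {μ : ℝ} (h : IsStokesEigenvalue A B μ) (hμ : μ ≠ 0) :
    ∃ x : EuclideanSpace 𝕜 (Fin m), ‖x‖ = 1 ∧ (μ = pPlus A B x ∨ μ = pMinus A B x) := by
  have hμ' : (μ : 𝕜) ≠ 0 := by simpa using hμ
  obtain ⟨x, y, h0, h1, h2⟩ := isStokesEigenvalue_iff.1 h
  have hx : x ≠ 0 := by
    rintro rfl
    rw [Matrix.mulVec_zero] at h2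
    have : y = 0 := (smul_eq_zero.1 h2.symm).resolve_left hμ'
    exact h0.elim (fun h => h rfl) fun h => h this
  have hpen : pencil A B μ *ᵥ x = 0 := by
    rw [pencil, Matrix.sub_mulVec, Matrix.sub_mulVec, Matrix.smul_mulVec, Matrix.smul_mulVec,
      Matrix.one_mulVec, ← Matrix.mulVec_mulVec, h2, Matrix.mulVec_smul, pow_two, mul_smul, ← h1,
      smul_add]
    abel
  obtain ⟨u, hu, hxu⟩ := exists_unit_smul_eq (x := WithLp.toLp 2 x) (by simpa using hx)
  refine ⟨u, hu, ?_⟩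
  have hq : quadForm (pencil A B μ) (WithLp.toLp 2 x) = 0 := by simp [quadForm, hpen]
  rw [hxu, quadForm_smul, quadForm_pencil_of_norm_eq_one A B μ hu] at hq
  have hn : ‖WithLp.toLp 2 x‖ ^ 2 ≠ 0 := by simpa using hx
  rcases mul_eq_zero.1 ((mul_eq_zero.1 hq).resolve_left hn) with h | h
  · exact Or.inl (sub_eq_zero.1 h)
  · exact Or.inr (sub_eq_zero.1 h)

theorem exists_isStokesEigenvalue_of_mem_spectrum {A : Matrix (Fin m) (Fin m) 𝕜}
    (hA : A.PosSemidef) {B : Matrix (Fin m) (Fin k) 𝕜} {z : 𝕜}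
    (hz : z ∈ spectrum 𝕜 (stokesMatrix A B)) : ∃ μ : ℝ, (μ : 𝕜) = z ∧ IsStokesEigenvalue A B μ := by
  have h1 := hz
  rw [← Matrix.spectrum_toLpLin 2] at h1
  have h2 := (Matrix.isSymmetric_toEuclideanLin_iff.2
    (stokesMatrix_isHermitian hA B)).conj_eigenvalue_eq_self
      (Module.End.HasEigenvalue.of_mem_spectrum h1)
  have h3 := RCLike.conj_eq_iff_re.1 h2
  refine ⟨RCLike.re z, h3, ?_⟩
  rw [← Matrix.spectrum_toLin'] at hz
  rw [IsStokesEigenvalue, h3]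
  exact Module.End.HasEigenvalue.of_mem_spectrum hz

/-! ### The eigenvalue zero and the kernel of `B`. -/

theorem isStokesEigenvalue_zero_iff {A : Matrix (Fin m) (Fin m) 𝕜}
    {B : Matrix (Fin m) (Fin k) 𝕜}
    (hpos : ∀ x : EuclideanSpace 𝕜 (Fin m), x ≠ 0 → 0 < quadForm A x + quadForm (B * Bᴴ) x) :
    IsStokesEigenvalue A B 0 ↔ LinearMap.ker (Matrix.toLin' B) ≠ ⊥ := by
  rw [isStokesEigenvalue_iff, Submodule.ne_bot_iff]
  simp only [RCLike.ofReal_zero, zero_smul, LinearMap.mem_ker, Matrix.toLin'_apply]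
  constructor
  · rintro ⟨x, y, h0, h1, h2⟩
    have hb : quadForm (B * Bᴴ) (WithLp.toLp 2 x) = 0 := by
      simp [quadForm_mul_conjTranspose, h2]
    -- From `A x = -B y` and `B* x = 0` follows `x* A x = -(B* x)* y = 0`.
    have ha : quadForm A (WithLp.toLp 2 x) = 0 := by
      rw [quadForm, eq_neg_of_add_eq_zero_left h1, dotProduct_neg, Matrix.dotProduct_mulVec,
        ← Matrix.conjTranspose_conjTranspose B, ← Matrix.star_mulVec]
      simp [h2]
    have hx : x = 0 := by
      by_contra hx
      have := hpos (WithLp.toLp 2 x) (by simpa using hx)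
      rw [ha, hb] at this
      simp at this
    subst hx
    refine ⟨y, by simpa using h1, by simpa using h0⟩
  · rintro ⟨y, hy, hy0⟩
    exact ⟨0, y, Or.inr hy0, by simpa using hy, by simp⟩

theorem toEuclideanLin_conjTranspose_eq_zero_of_pMinus_eq_zero {A : Matrix (Fin m) (Fin m) 𝕜}
    {B : Matrix (Fin m) (Fin k) 𝕜} {x : EuclideanSpace 𝕜 (Fin m)} (h : pMinus A B x = 0) :
    Bᴴ.toEuclideanLin x = 0 := by
  have h1 := pPlus_mul_pMinus A B x
  rw [h, mul_zero, quadForm_mul_conjTranspose] at h1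
  simpa using h1.symm

/-- If `B` were injective, it would be square and onto, so `x = B y` and `⟨x, x⟩ = ⟨B* x, y⟩ = 0`.
-/
theorem ker_toLin'_ne_bot_of_le (hmk : m ≤ k) {B : Matrix (Fin m) (Fin k) 𝕜}
    {x : EuclideanSpace 𝕜 (Fin m)} (hx0 : x ≠ 0) (hx : Bᴴ.toEuclideanLin x = 0) :
    LinearMap.ker (Matrix.toLin' B) ≠ ⊥ := by
  intro hker
  have hinj := LinearMap.ker_eq_bot.1 hker
  have hkm : k ≤ m := by simpa using LinearMap.finrank_le_finrank_of_injective hinj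
  have hsurj := (LinearMap.injective_iff_surjective_of_finrank_eq_finrank
    (by simpa using le_antisymm hkm hmk)).1 hinj
  obtain ⟨y, hy⟩ := hsurj x.ofLp
  have hy' : B.toEuclideanLin (WithLp.toLp 2 y) = x := by
    refine WithLp.ofLp_injective 2 ?_
    simpa using hy
  apply hx0
  rw [← inner_self_eq_zero (𝕜 := 𝕜)]
  nth_rewrite 2 [← hy']
  rw [← LinearMap.adjoint_inner_left, ← Matrix.toEuclideanLin_conjTranspose_eq_adjoint, hx,
    inner_zero_left]

theorem ker_toLin'_ne_bot_of_conjTranspose_eq_zero (hk : 0 < k) {B : Matrix (Fin m) (Fin k) 𝕜}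
    (h : ∀ x : EuclideanSpace 𝕜 (Fin m), ‖x‖ = 1 → Bᴴ.toEuclideanLin x = 0) :
    LinearMap.ker (Matrix.toLin' B) ≠ ⊥ := by
  have hB : Bᴴ.toEuclideanLin = 0 := by
    ext1 x
    by_cases hx : x = 0
    · simp [hx]
    · obtain ⟨u, hu, hxu⟩ := exists_unit_smul_eq hx
      rw [hxu, map_smul, h u hu, smul_zero, LinearMap.zero_apply]
  have hB0 : B = 0 := by simpa using hB
  subst hB0
  have : Nonempty (Fin k) := ⟨⟨0, hk⟩⟩
  simp

end Stokes

/-! ### Assembly of the theorem. -/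

theorem mainTheorem4 {𝕜 : Type*} [RCLike 𝕜] {m k : ℕ} (hm : 0 < m) (hk : 0 < k)
    (A : Matrix (Fin m) (Fin m) 𝕜) (B : Matrix (Fin m) (Fin k) 𝕜) (hA : A.PosSemidef)
    (hAB : LinearMap.ker (Matrix.toLin' A) ⊓ LinearMap.ker (Matrix.toLin' Bᴴ) = ⊥) :
    -- the four extremal values are attained
    (∃ pPlusMax pPlusMin pMinusMax pMinusMin : ℝ,
      IsGreatest (sphereValues (pPlus A B)) pPlusMax ∧
      IsLeast (sphereValues (pPlus A B)) pPlusMin ∧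
      IsGreatest (sphereValues (pMinus A B)) pMinusMax ∧
      IsLeast (sphereValues (pMinus A B)) pMinusMin ∧
      -- extremal eigenvalues
      IsStokesEigenvalue A B pPlusMax ∧
      IsStokesEigenvalue A B pPlusMin ∧
      IsStokesEigenvalue A B pMinusMin ∧
      (IsStokesEigenvalue A B pMinusMax ↔
        (pMinusMax ≠ 0 ∨ LinearMap.ker (Matrix.toLin' B) ≠ ⊥)) ∧
      (m ≤ k → IsStokesEigenvalue A B pMinusMax) ∧
      -- spectral inclusion
      spectrum 𝕜 (stokesMatrix A B) ⊆
        (fun r : ℝ => (r : 𝕜)) ''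
          (Set.Icc pMinusMin pMinusMax ∪ Set.Icc pPlusMin pPlusMax ∪ {0}) ∧
      pMinusMax ≤ 0 ∧ 0 ≤ pPlusMin ∧ pMinusMax < pPlusMin) ∧
    -- the `m` largest eigenvalues are positive, the `k` remaining ones are nonpositive
    (∀ i : Fin (Fintype.card (Fin m ⊕ Fin k)), (i : ℕ) < m → 0 < stokesEigenvalue hA B i) ∧
    (∀ i : Fin (Fintype.card (Fin m ⊕ Fin k)), m ≤ (i : ℕ) →
        stokesEigenvalue hA B i ≤ 0) ∧
    -- monotonicity in `A`
    (∀ (A' : Matrix (Fin m) (Fin m) 𝕜) (hA' : A'.PosSemidef),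
      (∀ x, quadForm A x ≤ quadForm A' x) →
      ∀ i, stokesEigenvalue hA B i ≤ stokesEigenvalue hA' B i) ∧
    -- monotonicity in `B B*`
    (∀ B' : Matrix (Fin m) (Fin k) 𝕜,
      (∀ x, quadForm (B * Bᴴ) x ≤ quadForm (B' * B'ᴴ) x) →
      (∀ i : Fin (Fintype.card (Fin m ⊕ Fin k)), (i : ℕ) < m →
        stokesEigenvalue hA B i ≤ stokesEigenvalue hA B' i) ∧
      (∀ i : Fin (Fintype.card (Fin m ⊕ Fin k)), m ≤ (i : ℕ) →
        stokesEigenvalue hA B' i ≤ stokesEigenvalue hA B i)) := by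
  have hpos := quadForm_add_pos hA hAB
  refine ⟨?_, stokesEigenvalue_pos hA hpos, stokesEigenvalue_nonpos hA B,
    fun A' hA' h => stokesEigenvalue_mono_left hA hA' B h,
    fun B' h => ⟨stokesEigenvalue_le_of_quadForm_le hA hpos h,
      stokesEigenvalue_ge_of_quadForm_le hA h⟩⟩
  obtain ⟨a, ha⟩ := (isCompact_sphereValues (continuous_pPlus A B)).exists_isGreatest
    (sphereValues_nonempty hm _)
  obtain ⟨b, hb⟩ := (isCompact_sphereValues (continuous_pPlus A B)).exists_isLeast
    (sphereValues_nonempty hm _)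
  obtain ⟨c, hc⟩ := (isCompact_sphereValues (continuous_pMinus A B)).exists_isGreatest
    (sphereValues_nonempty hm _)
  obtain ⟨d, hd⟩ := (isCompact_sphereValues (continuous_pMinus A B)).exists_isLeast
    (sphereValues_nonempty hm _)
  have mem : ∀ {f : EuclideanSpace 𝕜 (Fin m) → ℝ} {x}, ‖x‖ = 1 → f x ∈ sphereValues f :=
    fun hx => ⟨_, by simpa using hx, rfl⟩
  have hplus : ∀ x : EuclideanSpace 𝕜 (Fin m), ‖x‖ = 1 → 0 < pPlus A B x := fun x hx =>
    pPlus_pos hA (hpos x (by rintro rfl; simp at hx))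
  have hminus := pMinus_nonpos A B
  obtain ⟨xa, hxa, hxa'⟩ := ha.1
  obtain ⟨xb, hxb, hxb'⟩ := hb.1
  obtain ⟨xc, hxc, hxc'⟩ := hc.1
  obtain ⟨xd, hxd, hxd'⟩ := hd.1
  rw [mem_sphere_zero_iff_norm] at hxa hxb hxc hxd
  have ha0 : 0 < a := hxa' ▸ hplus xa hxa
  have hb0 : 0 < b := hxb' ▸ hplus xb hxb
  have hc0 : c ≤ 0 := hxc' ▸ hminus xc
  have hd0 : d ≤ 0 := hxd' ▸ hminus xd
  have hcne : c ≠ 0 → IsStokesEigenvalue A B c := fun hne => by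
    have hneg := lt_of_le_of_ne hc0 hne
    refine isStokesEigenvalue_of_quadForm_pencil_nonpos hA hne (fun x hx => ?_) hxc
      (by rw [hxc']; ring)
    -- Here `c ≤ 0 < p₊(x)` and `p₋(x) ≤ c`, so the factors have opposite signs.
    exact mul_nonpos_of_nonpos_of_nonneg (by linarith [hplus x hx])
      (sub_nonneg.2 (hc.2 (mem hx)))
  have hciff : IsStokesEigenvalue A B c ↔
      (c ≠ 0 ∨ LinearMap.ker (Matrix.toLin' B) ≠ ⊥) := by
    by_cases hc1 : c = 0
    · rw [hc1, isStokesEigenvalue_zero_iff hpos]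
      simp
    · simp [hc1, hcne hc1]
  refine ⟨a, b, c, d, ha, hb, hc, hd, ?_, ?_, ?_, hciff, ?_, ?_, hc0, hb0.le,
    hc0.trans_lt hb0⟩
  · refine isStokesEigenvalue_of_quadForm_pencil_nonneg hA ha0.ne' (fun x hx => ?_) hxa
      (by rw [hxa']; ring)
    exact mul_nonneg (sub_nonneg.2 (ha.2 (mem hx))) (by linarith [hminus x])
  · refine isStokesEigenvalue_of_quadForm_pencil_nonpos hA hb0.ne' (fun x hx => ?_) hxb
      (by rw [hxb']; ring)
    exact mul_nonpos_of_nonpos_of_nonneg (sub_nonpos.2 (hb.2 (mem hx)))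
      (by linarith [hminus x])
  -- A zero minimum of the nonpositive `p₋` forces `p₋ = 0` on the whole sphere, hence `B = 0`,
  -- whose kernel is nontrivial since `k > 0`.
  · by_cases hd1 : d = 0
    · rw [hd1, isStokesEigenvalue_zero_iff hpos]
      refine ker_toLin'_ne_bot_of_conjTranspose_eq_zero hk fun x hx =>
        toEuclideanLin_conjTranspose_eq_zero_of_pMinus_eq_zero (A := A)
          (le_antisymm (hminus x) (hd1 ▸ hd.2 (mem hx)))
    · have hneg := lt_of_le_of_ne hd0 hd1
      refine isStokesEigenvalue_of_quadForm_pencil_nonneg hA hd1 (fun x hx => ?_) hxd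
        (by rw [hxd']; ring)
      exact mul_nonneg_of_nonpos_of_nonpos (by linarith [hplus x hx])
        (sub_nonpos.2 (hd.2 (mem hx)))
  · intro hmk
    rw [hciff]
    by_cases hc1 : c = 0
    · exact Or.inr (ker_toLin'_ne_bot_of_le hmk (x := xc) (by rintro rfl; simp at hxc)
        (toEuclideanLin_conjTranspose_eq_zero_of_pMinus_eq_zero (hxc'.trans hc1)))
    · exact Or.inl hc1
  · intro z hz
    obtain ⟨μ, rfl, hμ⟩ := exists_isStokesEigenvalue_of_mem_spectrum hA hz
    refine ⟨μ, ?_, rfl⟩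
    by_cases hμ0 : μ = 0
    · exact Or.inr hμ0
    · obtain ⟨x, hx, rfl | rfl⟩ := hμ.exists_eq hμ0
      · exact Or.inl (Or.inr ⟨hb.2 (mem hx), ha.2 (mem hx)⟩)
      · exact Or.inl (Or.inl ⟨hd.2 (mem hx), hc.2 (mem hx)⟩)
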